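/- Let $\mathcal H=L^2(\mathbb R)$ and, for $q,p\in\mathbb R$, let $(U(q)\psi)(x)=\psi(x-q)$, $(V(p)\psi)(x)=e^{ipx}\psi(x)$ and $W(q,p)=e^{iqp/2}U(q)V(p)$. An observable on $\mathbb R^n$ is a map $E:\mathcal B(\mathbb R^n)\to\mathcal L(\mathcal H)$ from the Borel sets to the bounded operators on $\mathcal H$ that is $\sigma$-additive in the weak operator topology, with $E(X)\ge 0$ for all $X$ and $E(\mathbb R^n)=I$. An observable $E$ on $\mathbb R$ is a position observable if $U(q)E(X)U(q)^*=E(X+q)$ and $V(p)E(X)V(p)^*=E(X)$ for all $q,p\in\mathbb R$ and $X\in\mathcal B(\mathbb R)$. An observable $F$ on $\mathbb R$ is a momentum observable if $V(p)F(Y)V(p)^*=F(Y+p)$ and $U(q)F(Y)U(q)^*=F(Y)$ for all $q,p\in\mathbb R$ and $Y\in\mathcal B(\mathbb R)$. An observable $G$ on $\mathbb R^2$ is a joint observable of $E$ and $F$ if $E(X)=G(X\times\mathbb R)$ and $F(Y)=G(\mathbb R\times Y)$ for all $X,Y\in\mathcal B(\mathbb R)$, and it is a covariant phase space observable if $W(q,p)G(Z)W(q,p)^*=G(Z+(q,p))$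 for all $q,p\in\mathbb R$ and $Z\in\mathcal B(\mathbb R^2)$. Proposition. Let $E$ be a position observable and $F$ a momentum observable. If $E$ and $F$ have a joint observable, then they also have a joint observable which is a covariant phase space observable. -/

import Mathlib

open MeasureTheory
open scoped InnerProductSpace ENNReal

namespace PhaseSpace

section Observables

/-- An observable on the measurable space `Ω` with values in the bounded operators on `H`: a
normalized positive operator measure, `σ`-additive with respect to the weak operator topology.
Only the values on measurable sets are meaningful; every notion below looks at these only. -/
structure Observable (Ω : Type*) [MeasurableSpace Ω] (H : Type*) [NormedAddCommGroup H]
    [InnerProductSpace ℂ H] where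
  /-- The operator attached to a set of outcomes. -/
  op : Set Ω → H →L[ℂ] H
  isPositive : ∀ X : Set Ω, MeasurableSet X → (op X).IsPositive
  op_univ : op Set.univ = ContinuousLinearMap.id ℂ H
  hasSum_iUnion : ∀ X : ℕ → Set Ω, (∀ i, MeasurableSet (X i)) →
    Pairwise (fun i j => Disjoint (X i) (X j)) →
    ∀ φ ψ : H, HasSum (fun i => ⟪φ, op (X i) ψ⟫_ℂ) ⟪φ, op (⋃ i, X i) ψ⟫_ℂ

/-- `G` is a joint observable of `E₁` and `E₂`: these are its first and second margins. -/
def IsJointObservable {H : Type*} [NormedAddCommGroup H] [InnerProductSpace ℂ H]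
    (G : Observable (ℝ × ℝ) H) (E₁ E₂ : Observable ℝ H) : Prop :=
  (∀ X : Set ℝ, MeasurableSet X → E₁.op X = G.op (X ×ˢ Set.univ)) ∧
  (∀ Y : Set ℝ, MeasurableSet Y → E₂.op Y = G.op (Set.univ ×ˢ Y))

end Observables

section Representations

/-- The Hilbert space `L²(ℝ)` of complex square integrable functions (Lebesgue measure). -/
abbrev L2R : Type := Lp ℂ 2 (volume : Measure ℝ)

/-- Space translations: `(U(q)ψ)(x) = ψ(x - q)`. -/
noncomputable def U (q : ℝ) : L2R →L[ℂ] L2R :=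
  (Lp.compMeasurePreservingₗᵢ ℂ (fun x : ℝ => x - q)
    (measurePreserving_sub_right volume q)).toContinuousLinearMap

theorem U_apply_ae (q : ℝ) (ψ : L2R) :
    (U q ψ : ℝ → ℂ) =ᵐ[volume] fun x => (ψ : ℝ → ℂ) (x - q) :=
  Lp.coeFn_compMeasurePreserving ψ (measurePreserving_sub_right volume q)

/-- The phase `x ↦ e^{ipx}`. -/
noncomputable def phase (p x : ℝ) : ℂ := Complex.exp (Complex.I * p * x)

theorem norm_phase (p x : ℝ) : ‖phase p x‖ = 1 := by
  have h : Complex.I * p * x = ((p * x : ℝ) : ℂ) * Complex.I := by push_cast; ring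
  rw [phase, h, Complex.norm_exp_ofReal_mul_I]

theorem continuous_phase (p : ℝ) : Continuous (phase p) := by
  unfold phase; fun_prop

theorem memLp_phase_mul (p : ℝ) (ψ : L2R) :
    MemLp (fun x => phase p x * (ψ : ℝ → ℂ) x) 2 (volume : Measure ℝ) :=
  (Lp.memLp ψ).of_le
    ((continuous_phase p).aestronglyMeasurable.mul (Lp.aestronglyMeasurable ψ))
    (Filter.Eventually.of_forall fun x => by rw [norm_mul, norm_phase, one_mul])

/-- Velocity boosts: `(V(p)ψ)(x) = e^{ipx} ψ(x)`. -/
noncomputable def V (p : ℝ) : L2R →L[ℂ] L2R :=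
  LinearIsometry.toContinuousLinearMap
    { toFun := fun ψ => (memLp_phase_mul p ψ).toLp _
      map_add' := fun ψ χ => by
        rw [← MemLp.toLp_add, MemLp.toLp_eq_toLp_iff]
        filter_upwards [Lp.coeFn_add ψ χ] with x hx
        simp only [hx, Pi.add_apply, mul_add]
      map_smul' := fun c ψ => by
        rw [RingHom.id_apply, ← MemLp.toLp_const_smul, MemLp.toLp_eq_toLp_iff]
        filter_upwards [Lp.coeFn_smul c ψ] with x hx
        simp only [hx, Pi.smul_apply, smul_eq_mul]
        ring
      norm_map' := fun ψ => by
        change ‖(memLp_phase_mul p ψ).toLp _‖ = ‖ψ‖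
        rw [Lp.norm_toLp, Lp.norm_def]
        congr 1
        refine eLpNorm_congr_norm_ae (Filter.Eventually.of_forall fun x => ?_)
        rw [norm_mul, norm_phase, one_mul] }

theorem V_apply_ae (p : ℝ) (ψ : L2R) :
    (V p ψ : ℝ → ℂ) =ᵐ[volume] fun x => Complex.exp (Complex.I * p * x) * (ψ : ℝ → ℂ) x :=
  MemLp.coeFn_toLp (memLp_phase_mul p ψ)

/-- The Weyl operators `W(q,p) = e^{iqp/2} U(q) V(p)`. -/
noncomputable def W (q p : ℝ) : L2R →L[ℂ] L2R :=
  Complex.exp (Complex.I * q * p / 2) • (U q ∘L V p)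

end Representations

section PositionMomentum

/-- A position observable: translation covariant and velocity boost invariant. -/
def IsPositionObservable (E : Observable ℝ L2R) : Prop :=
  ∀ (q p : ℝ) (X : Set ℝ), MeasurableSet X →
    U q ∘L E.op X ∘L ContinuousLinearMap.adjoint (U q) = E.op ((fun x => x + q) '' X) ∧
    V p ∘L E.op X ∘L ContinuousLinearMap.adjoint (V p) = E.op X

/-- A momentum observable: velocity boost covariant and translation invariant. -/
def IsMomentumObservable (F : Observable ℝ L2R) : Prop :=
  ∀ (q p : ℝ) (Y : Set ℝ), MeasurableSet Y →
    V p ∘L F.op Y ∘L ContinuousLinearMap.adjoint (V p) = F.op ((fun y => y + p) '' Y) ∧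
    U q ∘L F.op Y ∘L ContinuousLinearMap.adjoint (U q) = F.op Y

/-- A covariant phase space observable: `W(q,p) G(Z) W(q,p)* = G(Z + (q,p))`. -/
def IsCovariantPhaseSpaceObservable (G : Observable (ℝ × ℝ) L2R) : Prop :=
  ∀ (q p : ℝ) (Z : Set (ℝ × ℝ)), MeasurableSet Z →
    W q p ∘L G.op Z ∘L ContinuousLinearMap.adjoint (W q p) = G.op ((fun z => z + (q, p)) '' Z)

end PositionMomentum

end PhaseSpace

/-! Average a joint observable `M` over phase space: the family `w ↦ W(w)* M(Z + w) W(w)` is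
bounded, and an invariant mean over the abelian group `ℝ × ℝ` turns it into an operator `g Z`.
Invariance of the mean makes `g` covariant, because the Weyl multiplier cancels under conjugation.
On strips `X × ℝ` and `ℝ × Y` the family is constant, since `E` and `F` are already covariant, so
`g` keeps both margins (`exists_covariant_average`).

The mean is only finitely additive, so `g` may fail to be `σ`-additive. Its margins are genuine
observables, however, and this forces tightness (`IsFinAdditiveOp.tight_of_margins`). The values of
each form `⟪ψ, g(·)ψ⟫` on compact sets therefore determine a Borel measure of the same total mass,
and these measures come from an observable `G` (`IsFinAdditiveOp.exists_observable`). Margins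
survive because domination with equal total mass is equality (`IsFinAdditive.map_innerMeasure`);
covariance survives because homeomorphisms preserve compact sets
(`IsFinAdditive.innerMeasure_preimage`). -/

open Filter Topology

namespace PhaseSpace

/-! ### Asymptotically invariant averages on an abelian group. -/

section Averages

variable {G V V' : Type*} [AddCommGroup G] [NormedAddCommGroup V] [NormedSpace ℝ V]
  [NormedAddCommGroup V'] [NormedSpace ℝ V']

/-- The average of the translates of `f` along `0, g, …, n • g`, where `x = (g, n)`. -/
noncomputable def avgStep (x : G × ℕ) (f : G → V) : G → V :=
  fun z => ((x.2 : ℝ) + 1)⁻¹ • ∑ k ∈ Finset.range (x.2 + 1), f (z + k • x.1)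

/-- The iterated average along all members of a list. -/
noncomputable def avg (L : List (G × ℕ)) (f : G → V) : G → V := L.foldr avgStep f

theorem avgStep_left_comm (x y : G × ℕ) (f : G → V) :
    avgStep x (avgStep y f) = avgStep y (avgStep x f) := by
  funext z
  simp only [avgStep, ← Finset.smul_sum]
  rw [smul_comm, Finset.sum_comm]
  simp only [add_right_comm]

theorem avg_perm {L L' : List (G × ℕ)} (h : L.Perm L') (f : G → V) : avg L f = avg L' f :=
  haveI : LeftCommutative (avgStep (G := G) (V := V)) := ⟨avgStep_left_comm⟩
  h.foldr_eq f

/-- Every averaging step is a convex combination. Taking `s` to be a ball, a singleton or the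
positive cone gives the norm bound, the value on constants and positivity. -/
theorem avg_mem_of_convex {s : Set V} (hs : Convex ℝ s) (L : List (G × ℕ)) {f : G → V}
    (hf : ∀ z, f z ∈ s) : ∀ z, avg L f z ∈ s := by
  induction L with
  | nil => exact hf
  | cons x L ih =>
    intro z
    change avgStep x (avg L f) z ∈ s
    rw [avgStep, Finset.smul_sum]
    refine hs.sum_mem (fun _ _ => by positivity) ?_ fun _ _ => ih _
    rw [Finset.sum_const, Finset.card_range, nsmul_eq_mul]
    push_cast
    exact mul_inv_cancel₀ (by positivity)

theorem avg_norm_le (L : List (G × ℕ)) {f : G → V} {C : ℝ} (hf : ∀ z, ‖f z‖ ≤ C) (z : G) :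
    ‖avg L f z‖ ≤ C := by
  simpa using avg_mem_of_convex (convex_closedBall (0 : V) C) L (by simpa using hf) z

theorem avg_const (L : List (G × ℕ)) (v : V) (z : G) : avg L (fun _ => v) z = v :=
  avg_mem_of_convex (convex_singleton v) L (fun _ => rfl) z

theorem avg_add (L : List (G × ℕ)) (f g : G → V) :
    avg L (fun z => f z + g z) = fun z => avg L f z + avg L g z := by
  induction L with
  | nil => rfl
  | cons x L ih =>
    change avgStep x (avg L _) = fun z => avgStep x (avg L f) z + avgStep x (avg L g) z
    rw [ih]
    funext z
    simp only [avgStep, Finset.sum_add_distrib, smul_add]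

theorem avg_map (T : V →ₗ[ℝ] V') (L : List (G × ℕ)) (f : G → V) :
    avg L (fun z => T (f z)) = fun z => T (avg L f z) := by
  induction L with
  | nil => rfl
  | cons x L ih =>
    change avgStep x (avg L _) = fun z => T (avgStep x (avg L f) z)
    rw [ih]
    funext z
    simp only [avgStep, map_smul, map_sum]

theorem avg_sub (L : List (G × ℕ)) (f g : G → V) :
    avg L (fun z => f z - g z) = fun z => avg L f z - avg L g z := by
  have h := avg_map (-LinearMap.id : V →ₗ[ℝ] V) L g
  simp only [LinearMap.neg_apply, LinearMap.id_apply] at h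
  simp only [sub_eq_add_neg, avg_add, h]

/-- The sum telescopes, leaving two boundary terms divided by the number of summands. -/
theorem norm_avgStep_shift_sub_le (x : G × ℕ) {f : G → V} {C : ℝ} (hf : ∀ z, ‖f z‖ ≤ C) (z : G) :
    ‖avgStep x (fun z => f (z + x.1) - f z) z‖ ≤ 2 * C / (x.2 + 1) := by
  have h : ∑ k ∈ Finset.range (x.2 + 1), (f (z + k • x.1 + x.1) - f (z + k • x.1))
      = f (z + (x.2 + 1) • x.1) - f z := by
    have := Finset.sum_range_sub (fun k : ℕ => f (z + k • x.1)) (x.2 + 1)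
    simpa only [succ_nsmul, add_assoc, zero_smul, add_zero] using this
  rw [avgStep, h, norm_smul, Real.norm_of_nonneg (by positivity), inv_mul_eq_div]
  gcongr
  exact (norm_sub_le _ _).trans (by linarith [hf (z + (x.2 + 1) • x.1), hf z])

theorem norm_avg_shift_sub_le {L : List (G × ℕ)} {x : G × ℕ} (hx : x ∈ L) {f : G → V} {C : ℝ}
    (hf : ∀ z, ‖f z‖ ≤ C) (z : G) :
    ‖avg L (fun z => f (z + x.1) - f z) z‖ ≤ 2 * C / (x.2 + 1) := by
  classical
  -- The averages commute, so `x` can be made the innermost one; the remaining averages do not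
  -- increase the bound.
  have hp : L.Perm (L.erase x ++ [x]) :=
    (List.perm_cons_erase hx).trans (List.perm_append_singleton x _).symm
  rw [avg_perm hp, avg, List.foldr_append]
  exact avg_norm_le _ (norm_avgStep_shift_sub_le x hf) z

/-- Finite sets of pairs ordered by inclusion eventually contain `(g, n)` for any prescribed `n`, so
one net of averages is asymptotically invariant under all shifts at once. Its limit along an
ultrafilter serves as the invariant mean. -/
theorem tendsto_avg_shift_sub {f : G → V} {C : ℝ} (hf : ∀ z, ‖f z‖ ≤ C) (g : G) :
    Tendsto (fun s : Finset (G × ℕ) => avg s.toList (fun z => f (z + g)) 0 - avg s.toList f 0)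
      atTop (𝓝 0) := by
  rw [Metric.tendsto_nhds]
  intro ε hε
  have hC : 0 ≤ C := (norm_nonneg _).trans (hf 0)
  obtain ⟨n, hn⟩ := exists_nat_gt (2 * C / ε)
  filter_upwards [eventually_ge_atTop {(g, n)}] with s hs
  rw [dist_zero_right]
  have hmem : (g, n) ∈ s.toList := by simpa using hs
  have h := norm_avg_shift_sub_le hmem hf 0
  rw [avg_sub] at h
  refine h.trans_lt ?_
  rw [div_lt_iff₀ hε] at hn
  rw [div_lt_iff₀ (by positivity)]
  simp only
  nlinarith

end Averages

/-! ### Weak operator limits and positivity. -/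

section WeakLimits

variable {H : Type*} [NormedAddCommGroup H] [InnerProductSpace ℂ H]

/-- Bounded families of operators converge weakly along ultrafilters. -/
theorem exists_weak_limit [CompleteSpace H] {ι : Type*} (l : Ultrafilter ι) (A : ι → H →L[ℂ] H) {C : ℝ}
    (hA : ∀ i, ‖A i‖ ≤ C) :
    ∃ T : H →L[ℂ] H, ∀ φ ψ : H, Tendsto (fun i => ⟪φ, A i ψ⟫_ℂ) l (𝓝 ⟪φ, T ψ⟫_ℂ) := by
  have hbd : ∀ φ ψ i, ‖⟪A i φ, ψ⟫_ℂ‖ ≤ C * ‖φ‖ * ‖ψ‖ := fun φ ψ i =>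
    (norm_inner_le_norm _ _).trans
      (mul_le_mul_of_nonneg_right ((A i).le_of_opNorm_le (hA i) φ) (norm_nonneg _))
  have hex : ∀ φ ψ, ∃ b ∈ Metric.closedBall (0 : ℂ) (C * ‖φ‖ * ‖ψ‖),
      Tendsto (fun i => ⟪A i φ, ψ⟫_ℂ) l (𝓝 b) := fun φ ψ =>
    (isCompact_closedBall (0 : ℂ) (C * ‖φ‖ * ‖ψ‖)).ultrafilter_le_nhds
      (l.map fun i => ⟪A i φ, ψ⟫_ℂ) (le_principal_iff.2 (mem_map.2 (Eventually.of_forall fun i => by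
        simpa using hbd φ ψ i)))
  choose B hBmem hB using hex
  -- The pointwise limits form a bounded sesquilinear form, which is represented by an operator. The
  -- operator acts on the left entry here; conjugation moves it to the right at the end.
  let B' : H →L⋆[ℂ] H →L[ℂ] ℂ := LinearMap.mkContinuous₂
    (LinearMap.mk₂'ₛₗ (starRingEnd ℂ) (RingHom.id ℂ) B
      (fun φ φ' ψ => tendsto_nhds_unique (hB _ _)
        (by simpa only [map_add, inner_add_left] using (hB φ ψ).add (hB φ' ψ)))
      (fun c φ ψ => tendsto_nhds_unique (hB _ _)
        (by simpa only [map_smul, inner_smul_left, smul_eq_mul] using (hB φ ψ).const_mul _))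
      (fun φ ψ ψ' => tendsto_nhds_unique (hB _ _)
        (by simpa only [inner_add_right] using (hB φ ψ).add (hB φ ψ')))
      (fun c φ ψ => tendsto_nhds_unique (hB _ _)
        (by simpa only [inner_smul_right, smul_eq_mul, RingHom.id_apply] using (hB φ ψ).const_mul _))) C
    (fun φ ψ => by simpa using hBmem φ ψ)
  refine ⟨InnerProductSpace.continuousLinearMapOfBilin B', fun φ ψ => ?_⟩
  have h := (Complex.continuous_conj.tendsto _).comp (hB ψ φ)
  have e : B ψ φ = ⟪InnerProductSpace.continuousLinearMapOfBilin B' ψ, φ⟫_ℂ := by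
    rw [InnerProductSpace.continuousLinearMapOfBilin_apply]; rfl
  rw [e] at h
  simpa only [Function.comp_def, inner_conj_symm] using h

theorem isPositive_of_inner_eq_ofReal {T : H →L[ℂ] H} {r : H → ℝ} (hr : ∀ ψ, 0 ≤ r ψ)
    (h : ∀ ψ, ⟪ψ, T ψ⟫_ℂ = r ψ) : T.IsPositive := by
  have h' : ∀ ψ, ⟪T ψ, ψ⟫_ℂ = r ψ := fun ψ => by
    rw [← inner_conj_symm, h, Complex.conj_ofReal]
  rw [ContinuousLinearMap.isPositive_iff_complex]
  exact fun ψ => by simp [h', hr]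

theorem inner_eq_ofReal_re {T : H →L[ℂ] H} (hT : T.IsPositive) (ψ : H) :
    ⟪ψ, T ψ⟫_ℂ = ((⟪ψ, T ψ⟫_ℂ).re : ℂ) := by
  have := hT.inner_nonneg_right ψ
  exact Complex.eq_re_of_ofReal_le (r := 0) (by simpa using this)

theorem norm_le_one_of_isPositive [CompleteSpace H] {T : H →L[ℂ] H} (hT : T.IsPositive)
    (h : ∀ ψ, (⟪ψ, T ψ⟫_ℂ).re ≤ ‖ψ‖ ^ 2) : ‖T‖ ≤ 1 := by
  rw [CStarAlgebra.norm_le_one_iff_of_nonneg T (by rwa [ContinuousLinearMap.nonneg_iff_isPositive]),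
    ContinuousLinearMap.le_def]
  refine isPositive_of_inner_eq_ofReal (r := fun ψ => ‖ψ‖ ^ 2 - (⟪ψ, T ψ⟫_ℂ).re)
    (fun ψ => sub_nonneg.2 (h ψ)) fun ψ => ?_
  rw [sub_apply, inner_sub_right, inner_eq_ofReal_re hT]
  simp [inner_self_eq_norm_sq_to_K]

theorem ext_inner_self {S T : H →L[ℂ] H} (h : ∀ ψ, ⟪ψ, S ψ⟫_ℂ = ⟪ψ, T ψ⟫_ℂ) : S = T := by
  refine ContinuousLinearMap.coe_inj.1 ((ext_inner_map _ _).1 fun ψ => ?_)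
  rw [← inner_conj_symm]
  conv_rhs => rw [← inner_conj_symm]
  exact congrArg _ (h ψ)

theorem convex_isPositive : Convex ℝ {T : H →L[ℂ] H | T.IsPositive} := by
  intro T hT T' hT' a b ha hb _
  have h : ∀ {c : ℝ} {S : H →L[ℂ] H}, 0 ≤ c → S.IsPositive → (c • S).IsPositive := fun {c S} hc hS =>
    hS.smul_of_nonneg (c := (c : ℂ)) (by simpa using hc)
  exact (h ha hT).add (h hb hT')

end WeakLimits

/-! ### Borel measures from finitely additive set functions on compact sets. -/

section InnerMeasure

/-- `m` is nonnegative and finitely additive on measurable sets. -/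
structure IsFinAdditive {Ω : Type*} [MeasurableSpace Ω] (m : Set Ω → ℝ) : Prop where
  nonneg : ∀ X, MeasurableSet X → 0 ≤ m X
  union : ∀ X Y, MeasurableSet X → MeasurableSet Y → Disjoint X Y → m (X ∪ Y) = m X + m Y

namespace IsFinAdditive

open TopologicalSpace

variable {Ω : Type*} [MeasurableSpace Ω] {m : Set Ω → ℝ}

theorem mono (h : IsFinAdditive m) {X Y : Set Ω} (hX : MeasurableSet X) (hY : MeasurableSet Y)
    (hXY : X ⊆ Y) : m X ≤ m Y := by
  have e := h.union X (Y \ X) hX (hY.diff hX) Set.disjoint_sdiff_right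
  rw [Set.union_sdiff_cancel hXY] at e
  linarith [h.nonneg _ (hY.diff hX)]

theorem union_le (h : IsFinAdditive m) {X Y : Set Ω} (hX : MeasurableSet X)
    (hY : MeasurableSet Y) : m (X ∪ Y) ≤ m X + m Y := by
  have e := h.union X (Y \ X) hX (hY.diff hX) Set.disjoint_sdiff_right
  rw [Set.union_sdiff_self] at e
  linarith [h.mono (hY.diff hX) hY Set.sdiff_subset]

variable [TopologicalSpace Ω] [T2Space Ω] [BorelSpace Ω]

/-- The restriction of a finitely additive set function to compact sets. -/
noncomputable def content (h : IsFinAdditive m) : Content Ω where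
  toFun K := (m K).toNNReal
  mono' K₁ K₂ hK := Real.toNNReal_mono
    (h.mono K₁.isCompact.measurableSet K₂.isCompact.measurableSet hK)
  sup_disjoint' K₁ K₂ hd _ _ := by
    rw [Compacts.coe_sup, h.union _ _ K₁.isCompact.measurableSet K₂.isCompact.measurableSet hd,
      Real.toNNReal_add (h.nonneg _ K₁.isCompact.measurableSet)
        (h.nonneg _ K₂.isCompact.measurableSet)]
  sup_le' K₁ K₂ := (Real.toNNReal_mono
    (h.union_le K₁.isCompact.measurableSet K₂.isCompact.measurableSet)).trans
      Real.toNNReal_add_le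

/-- The Borel measure obtained from the values of `m` on compact sets. -/
noncomputable def innerMeasure (h : IsFinAdditive m) : Measure Ω := h.content.measure

theorem innerMeasure_isOpen (h : IsFinAdditive m) {U : Set Ω} (hU : IsOpen U) :
    h.innerMeasure U = ⨆ K : {K : Compacts Ω // (K : Set Ω) ⊆ U}, ENNReal.ofReal (m K.1) := by
  rw [innerMeasure, Content.measure_apply _ hU.measurableSet, Content.outerMeasure_of_isOpen _ _ hU,
    Content.innerContent, iSup_subtype']
  rfl

theorem innerMeasure_isOpen_le (h : IsFinAdditive m) {U : Set Ω} (hU : IsOpen U) :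
    h.innerMeasure U ≤ ENNReal.ofReal (m U) := by
  rw [h.innerMeasure_isOpen hU]
  exact iSup_le fun K => ENNReal.ofReal_le_ofReal
    (h.mono K.1.isCompact.measurableSet hU.measurableSet K.2)

/-- Tightness is exactly what prevents mass from escaping when only compact sets are used. -/
theorem innerMeasure_univ (h : IsFinAdditive m)
    (ht : ∀ ε > 0, ∃ K : Set Ω, IsCompact K ∧ m Set.univ ≤ m K + ε) :
    h.innerMeasure Set.univ = ENNReal.ofReal (m Set.univ) := by
  refine le_antisymm (h.innerMeasure_isOpen_le isOpen_univ) ?_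
  refine ENNReal.le_of_forall_pos_le_add fun ε hε _ => ?_
  obtain ⟨K, hK, hKm⟩ := ht ε hε
  rw [h.innerMeasure_isOpen isOpen_univ]
  calc ENNReal.ofReal (m Set.univ) ≤ ENNReal.ofReal (m K + ε) := ENNReal.ofReal_le_ofReal hKm
    _ ≤ ENNReal.ofReal (m K) + ε := by
      simpa using ENNReal.ofReal_add_le (p := m K) (q := ε)
    _ ≤ _ := by
      gcongr
      exact le_iSup (fun K : {K : Compacts Ω // (K : Set Ω) ⊆ Set.univ} => ENNReal.ofReal (m K.1))
        ⟨⟨K, hK⟩, Set.subset_univ _⟩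

instance (h : IsFinAdditive m) : IsFiniteMeasure h.innerMeasure :=
  ⟨(h.innerMeasure_isOpen_le isOpen_univ).trans_lt ENNReal.ofReal_lt_top⟩

theorem tendsto_innerMeasure (h : IsFinAdditive m) {U : Set Ω} (hU : IsOpen U) :
    Tendsto (fun K : {K : Compacts Ω // (K : Set Ω) ⊆ U} => m K.1) atTop
      (𝓝 (h.innerMeasure.real U)) := by
  have hm : Monotone fun K : {K : Compacts Ω // (K : Set Ω) ⊆ U} => ENNReal.ofReal (m K.1) :=
    fun K K' hK => ENNReal.ofReal_le_ofReal
      (h.mono K.1.isCompact.measurableSet K'.1.isCompact.measurableSet hK)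
  have ht := tendsto_atTop_iSup hm
  rw [← h.innerMeasure_isOpen hU] at ht
  refine ((ENNReal.tendsto_toReal (measure_ne_top _ _)).comp ht).congr fun K => ?_
  exact ENNReal.toReal_ofReal (h.nonneg _ K.1.isCompact.measurableSet)

/-- A continuous image of the inner measure is the image of `m`, if the latter is a measure. -/
theorem map_innerMeasure (h : IsFinAdditive m)
    (ht : ∀ ε > 0, ∃ K : Set Ω, IsCompact K ∧ m Set.univ ≤ m K + ε) {f : Ω → ℝ}
    (hf : Continuous f) {μ : Measure ℝ} [IsFiniteMeasure μ]
    (hμ : ∀ X, IsOpen X → μ X = ENNReal.ofReal (m (f ⁻¹' X))) : h.innerMeasure.map f = μ := by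
  -- Outer regularity of `μ` reduces the inequality to open sets, where the inner measure is at most
  -- `m`.
  have hle : ∀ X, MeasurableSet X → h.innerMeasure.map f X ≤ μ X := fun X _ => by
    rw [X.measure_eq_iInf_isOpen μ]
    refine le_iInf₂ fun U hXU => le_iInf fun hU => (measure_mono hXU).trans ?_
    rw [Measure.map_apply hf.measurable hU.measurableSet, hμ U hU]
    exact h.innerMeasure_isOpen_le (hU.preimage hf)
  have huniv : h.innerMeasure.map f Set.univ = μ Set.univ := by
    rw [Measure.map_apply hf.measurable .univ, hμ _ isOpen_univ, Set.preimage_univ,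
      h.innerMeasure_univ ht]
  exact Measure.eq_of_le_of_measure_univ_eq (Measure.le_iff.2 hle) huniv

/-- Equivariance of the inner measure under a homeomorphism. -/
theorem innerMeasure_preimage (h : IsFinAdditive m) {m' : Set Ω → ℝ} (h' : IsFinAdditive m')
    (f : Ω ≃ₜ Ω) (hm : ∀ K, IsCompact K → m (f ⁻¹' K) = m' K) {Z : Set Ω} (hZ : MeasurableSet Z) :
    h.innerMeasure (f ⁻¹' Z) = h'.innerMeasure Z := by
  have hopen : ∀ U, IsOpen U → h.innerMeasure.map f U = h'.innerMeasure U := fun U hU => by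
    rw [Measure.map_apply f.continuous.measurable hU.measurableSet,
      h.innerMeasure_isOpen (hU.preimage f.continuous), h'.innerMeasure_isOpen hU]
    refine le_antisymm (iSup_le fun K => ?_) (iSup_le fun K => ?_)
    · refine le_iSup_of_le ⟨⟨f '' K.1, K.1.isCompact.image f.continuous⟩,
        Set.image_subset_iff.2 K.2⟩ (le_of_eq ?_)
      have e := hm _ (K.1.isCompact.image f.continuous)
      rw [f.preimage_image] at e
      exact congrArg _ e
    · refine le_iSup_of_le ⟨⟨f ⁻¹' K.1, f.isCompact_preimage.2 K.1.isCompact⟩,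
        Set.preimage_mono K.2⟩ (le_of_eq (congrArg _ (hm _ K.1.isCompact).symm))
  have : h.innerMeasure.map f = h'.innerMeasure := by
    refine ext_of_generate_finite _ (BorelSpace.measurable_eq)
      isPiSystem_isOpen (fun U hU => hopen U hU) (hopen _ isOpen_univ)
  rw [← this, Measure.map_apply f.continuous.measurable hZ]

end IsFinAdditive

end InnerMeasure

/-! ### Observables and their scalar measures. -/

section OperatorMeasures

variable {Ω : Type*} [MeasurableSpace Ω] {H : Type*} [NormedAddCommGroup H]
  [InnerProductSpace ℂ H]

theorem inner_map_eq_polarization (T : H →L[ℂ] H) (φ ψ : H) :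
    ⟪φ, T ψ⟫_ℂ = (⟪φ + ψ, T (φ + ψ)⟫_ℂ - ⟪φ - ψ, T (φ - ψ)⟫_ℂ
      - Complex.I * ⟪φ + Complex.I • ψ, T (φ + Complex.I • ψ)⟫_ℂ
      + Complex.I * ⟪φ - Complex.I • ψ, T (φ - Complex.I • ψ)⟫_ℂ) / 4 := by
  simp only [map_add, map_sub, map_smul, inner_add_left, inner_add_right, inner_sub_left,
    inner_sub_right, inner_smul_left, inner_smul_right, Complex.conj_I]
  ring_nf
  simp only [Complex.I_sq]
  ring

theorem hasSum_measureReal_iUnion {μ : Measure Ω} [IsFiniteMeasure μ] {f : ℕ → Set Ω}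
    (hd : Pairwise fun i j => Disjoint (f i) (f j)) (hf : ∀ i, MeasurableSet (f i)) :
    HasSum (fun i => μ.real (f i)) (μ.real (⋃ i, f i)) := by
  have h := measure_iUnion hd hf (μ := μ)
  have e : μ.real (⋃ i, f i) = ∑' i, μ.real (f i) := by
    rw [measureReal_def, h, ENNReal.tsum_toReal_eq fun _ => measure_ne_top _ _]
    rfl
  rw [e]
  exact (ENNReal.summable_toReal (h ▸ measure_ne_top _ _)).hasSum

/-- A family of measures whose values on a generating `π`-system are quadratic forms of operators
comes from an observable. -/
theorem exists_observable_of_measures [CompleteSpace H] (ν : H → Measure Ω)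
    (hν : ∀ ψ, ν ψ Set.univ = ENNReal.ofReal (‖ψ‖ ^ 2)) {S : Set (Set Ω)}
    (hS : ‹MeasurableSpace Ω› = MeasurableSpace.generateFrom S) (hpi : IsPiSystem S)
    (hex : ∀ Z ∈ S, ∃ A : H →L[ℂ] H, ∀ ψ, ⟪ψ, A ψ⟫_ℂ = (ν ψ).real Z) :
    ∃ G : Observable Ω H, ∀ Z, MeasurableSet Z → ∀ ψ, ⟪ψ, G.op Z ψ⟫_ℂ = (ν ψ).real Z := by
  have hfin : ∀ ψ, IsFiniteMeasure (ν ψ) := fun ψ => ⟨by rw [hν]; exact ENNReal.ofReal_lt_top⟩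
  have huniv : ∀ ψ, (ν ψ).real Set.univ = ‖ψ‖ ^ 2 := fun ψ => by
    rw [measureReal_def, hν, ENNReal.toReal_ofReal (by positivity)]
  have hone : ∀ ψ : H, ⟪ψ, (1 : H →L[ℂ] H) ψ⟫_ℂ = (‖ψ‖ ^ 2 : ℝ) := fun ψ => by
    simp [inner_self_eq_norm_sq_to_K]
  have hnorm : ∀ {Z} {A : H →L[ℂ] H}, (∀ ψ, ⟪ψ, A ψ⟫_ℂ = (ν ψ).real Z) → ‖A‖ ≤ 1 := fun {Z A} hA => by
    refine norm_le_one_of_isPositive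
      (isPositive_of_inner_eq_ofReal (fun _ => measureReal_nonneg) hA) fun ψ => ?_
    rw [hA, Complex.ofReal_re, ← huniv]
    exact measureReal_mono (Set.subset_univ _)
  have hall : ∀ Z, MeasurableSet Z → ∃ A : H →L[ℂ] H, ∀ ψ, ⟪ψ, A ψ⟫_ℂ = (ν ψ).real Z := by
    intro Z hZ
    induction Z, hZ using MeasurableSpace.induction_on_inter hS hpi with
    | empty => exact ⟨0, by simp⟩
    | basic Z hZ => exact hex Z hZ
    | compl Z hZ ih =>
      obtain ⟨A, hA⟩ := ih
      refine ⟨1 - A, fun ψ => ?_⟩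
      rw [sub_apply, inner_sub_right, hA, hone, measureReal_compl hZ, huniv]
      push_cast
      rfl
    | iUnion f hd hf ih =>
      choose A hA using ih
      have hsum : ∀ n ψ, ⟪ψ, (∑ i ∈ Finset.range n, A i) ψ⟫_ℂ
          = (ν ψ).real (⋃ i ∈ Finset.range n, f i) := fun n ψ => by
        rw [sum_apply, inner_sum, measureReal_biUnion_finset
          (fun i _ j _ hij => hd hij) (fun i _ => hf i)]
        push_cast
        exact Finset.sum_congr rfl fun i _ => hA i ψ
      -- The partial sums represent measures of finite unions, hence have norm at most one; a weak
      -- limit exists and its form is the measure of the whole union.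
      obtain ⟨T, hT⟩ := exists_weak_limit (Ultrafilter.of (atTop : Filter ℕ))
        (fun n => ∑ i ∈ Finset.range n, A i) (fun n => hnorm (hsum n))
      refine ⟨T, fun ψ => tendsto_nhds_unique (hT ψ ψ) ?_⟩
      refine Tendsto.mono_left ?_ (Ultrafilter.of_le _)
      have hs : HasSum (fun i => (ν ψ).real (f i)) ((ν ψ).real (⋃ i, f i)) := 
        hasSum_measureReal_iUnion hd hf
      simp only [sum_apply, inner_sum, hA]
      exact (Complex.hasSum_ofReal.2 hs).tendsto_sum_nat
  classical
  choose! A hA using hall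
  refine ⟨⟨A, fun Z hZ => isPositive_of_inner_eq_ofReal (fun _ => measureReal_nonneg) (hA Z hZ),
    ?_, fun X hX hd φ ψ => ?_⟩, hA⟩
  · exact ext_inner_self fun ψ => by rw [hA _ .univ, huniv]; exact (hone ψ).symm
  · have hs : ∀ ψ, HasSum (fun i => ⟪ψ, A (X i) ψ⟫_ℂ) ⟪ψ, A (⋃ i, X i) ψ⟫_ℂ := fun ψ => by
      rw [hA _ (MeasurableSet.iUnion hX)]
      simp only [fun i => hA _ (hX i)]
      exact Complex.hasSum_ofReal.2 (hasSum_measureReal_iUnion hd hX)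
    rw [inner_map_eq_polarization]
    simp only [fun i => inner_map_eq_polarization (A (X i)) φ ψ]
    exact ((((hs _).sub (hs _)).sub ((hs _).mul_left _)).add ((hs _).mul_left _)).div_const _

namespace Observable

theorem op_empty (E : Observable Ω H) : E.op ∅ = 0 := by
  refine ext_inner_self fun ψ => ?_
  have h := E.hasSum_iUnion (fun _ => ∅) (fun _ => .empty) (fun _ _ _ => disjoint_bot_left) ψ ψ
  have h0 := tendsto_nhds_unique h.summable.tendsto_atTop_zero tendsto_const_nhds
  simpa using h0.symm

/-- The measure `X ↦ ⟪ψ, E(X) ψ⟫`. -/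
noncomputable def measure (E : Observable Ω H) (ψ : H) : Measure Ω :=
  Measure.ofMeasurable (fun X _ => ENNReal.ofReal (⟪ψ, E.op X ψ⟫_ℂ).re) (by simp [E.op_empty])
    fun X hX hd => by
      have h : HasSum (fun i => (⟪ψ, E.op (X i) ψ⟫_ℂ).re) (⟪ψ, E.op (⋃ i, X i) ψ⟫_ℂ).re :=
        Complex.reCLM.hasSum (E.hasSum_iUnion X hX hd ψ ψ)
      rw [← h.tsum_eq]
      exact ENNReal.ofReal_tsum_of_nonneg
        (fun i => (E.isPositive _ (hX i)).re_inner_nonneg_right ψ) h.summable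

theorem measure_apply (E : Observable Ω H) (ψ : H) {X : Set Ω} (hX : MeasurableSet X) :
    E.measure ψ X = ENNReal.ofReal (⟪ψ, E.op X ψ⟫_ℂ).re :=
  Measure.ofMeasurable_apply X hX

instance (E : Observable Ω H) (ψ : H) : IsFiniteMeasure (E.measure ψ) :=
  ⟨by rw [measure_apply _ _ .univ]; exact ENNReal.ofReal_lt_top⟩

theorem inner_op_self (E : Observable Ω H) (ψ : H) {X : Set Ω} (hX : MeasurableSet X) :
    ⟪ψ, E.op X ψ⟫_ℂ = (E.measure ψ).real X := by
  have h := ENNReal.toReal_ofReal ((E.isPositive _ hX).re_inner_nonneg_right ψ)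
  rw [measureReal_def, E.measure_apply ψ hX]
  refine Eq.trans ?_ (congrArg Complex.ofReal h.symm)
  exact inner_eq_ofReal_re (E.isPositive _ hX) ψ

theorem op_union (E : Observable Ω H) {X Y : Set Ω} (hX : MeasurableSet X) (hY : MeasurableSet Y)
    (hd : Disjoint X Y) : E.op (X ∪ Y) = E.op X + E.op Y := by
  refine ext_inner_self fun ψ => ?_
  rw [add_apply, inner_add_right, E.inner_op_self ψ (hX.union hY),
    E.inner_op_self ψ hX, E.inner_op_self ψ hY, measureReal_union hd hY, Complex.ofReal_add]

end Observable

/-- `g` is positive, normalized and finitely additive on measurable sets. -/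
structure IsFinAdditiveOp (g : Set Ω → H →L[ℂ] H) : Prop where
  isPositive : ∀ X, MeasurableSet X → (g X).IsPositive
  univ : g Set.univ = 1
  union : ∀ X Y, MeasurableSet X → MeasurableSet Y → Disjoint X Y → g (X ∪ Y) = g X + g Y

theorem Observable.isFinAdditiveOp (E : Observable Ω H) : IsFinAdditiveOp E.op :=
  ⟨E.isPositive, E.op_univ, fun _ _ => E.op_union⟩

namespace IsFinAdditiveOp

variable {g : Set Ω → H →L[ℂ] H}

theorem form (hg : IsFinAdditiveOp g) (ψ : H) : IsFinAdditive fun X => (⟪ψ, g X ψ⟫_ℂ).re where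
  nonneg X hX := (hg.isPositive X hX).re_inner_nonneg_right ψ
  union X Y hX hY hd := by
    rw [hg.union X Y hX hY hd, add_apply, inner_add_right, Complex.add_re]

theorem form_univ (hg : IsFinAdditiveOp g) (ψ : H) : (⟪ψ, g Set.univ ψ⟫_ℂ).re = ‖ψ‖ ^ 2 := by
  rw [hg.univ]
  exact inner_self_eq_norm_sq (𝕜 := ℂ) ψ

theorem norm_le_one [CompleteSpace H] (hg : IsFinAdditiveOp g) {X : Set Ω} (hX : MeasurableSet X) :
    ‖g X‖ ≤ 1 :=
  norm_le_one_of_isPositive (hg.isPositive X hX) fun ψ =>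
    ((hg.form ψ).mono hX .univ (Set.subset_univ _)).trans_eq (hg.form_univ ψ)

/-- For open `U` the inner measure is the limit of `⟪ψ, g K ψ⟫` over compact `K ⊆ U`, so a weak
limit of the contractions `g K` represents it for all `ψ` simultaneously. Open sets form a
generating `π`-system. -/
theorem exists_observable [CompleteSpace H] [TopologicalSpace Ω] [T2Space Ω] [BorelSpace Ω]
    (hg : IsFinAdditiveOp g) (ht : ∀ ψ, ∀ ε > 0, ∃ K : Set Ω, IsCompact K ∧
      (⟪ψ, g Set.univ ψ⟫_ℂ).re ≤ (⟪ψ, g K ψ⟫_ℂ).re + ε) :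
    ∃ G : Observable Ω H, ∀ Z, MeasurableSet Z →
      ∀ ψ, ⟪ψ, G.op Z ψ⟫_ℂ = (hg.form ψ).innerMeasure.real Z := by
  refine exists_observable_of_measures (fun ψ => (hg.form ψ).innerMeasure)
    (fun ψ => by rw [(hg.form ψ).innerMeasure_univ (ht ψ), hg.form_univ])
    (BorelSpace.measurable_eq) isPiSystem_isOpen fun U hU => ?_
  have : Nonempty {K : TopologicalSpace.Compacts Ω // (K : Set Ω) ⊆ U} := ⟨⟨⊥, Set.empty_subset _⟩⟩
  have : IsDirectedOrder {K : TopologicalSpace.Compacts Ω // (K : Set Ω) ⊆ U} :=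
    ⟨fun K K' => ⟨⟨K.1 ⊔ K'.1, Set.union_subset K.2 K'.2⟩, le_sup_left (a := K.1),
      le_sup_right (a := K.1)⟩⟩
  obtain ⟨T, hT⟩ := exists_weak_limit
    (Ultrafilter.of (atTop : Filter {K : TopologicalSpace.Compacts Ω // (K : Set Ω) ⊆ U}))
    (fun K => g K.1) (fun K => hg.norm_le_one K.1.isCompact.measurableSet)
  refine ⟨T, fun ψ => tendsto_nhds_unique (hT ψ ψ) ?_⟩
  refine Tendsto.mono_left ?_ (Ultrafilter.of_le _)
  refine ((Complex.continuous_ofReal.tendsto _).comp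
    ((hg.form ψ).tendsto_innerMeasure hU)).congr fun K => ?_
  exact (inner_eq_ofReal_re (hg.isPositive _ K.1.isCompact.measurableSet) ψ).symm

/-- A finitely additive set function on the plane is tight if its margins are observables. -/
theorem tight_of_margins {g : Set (ℝ × ℝ) → H →L[ℂ] H} (hg : IsFinAdditiveOp g)
    {E F : Observable ℝ H} (hE : ∀ X, MeasurableSet X → g (X ×ˢ Set.univ) = E.op X)
    (hF : ∀ Y, MeasurableSet Y → g (Set.univ ×ˢ Y) = F.op Y) (ψ : H) {ε : ℝ} (hε : 0 < ε) :
    ∃ K : Set (ℝ × ℝ), IsCompact K ∧ (⟪ψ, g Set.univ ψ⟫_ℂ).re ≤ (⟪ψ, g K ψ⟫_ℂ).re + ε := by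
  have hK : ∀ A : Observable ℝ H, ∃ K : Set ℝ, IsCompact K ∧ (⟪ψ, A.op Kᶜ ψ⟫_ℂ).re ≤ ε / 2 := by
    intro A
    obtain ⟨K, -, hK, hKε⟩ := MeasurableSet.univ.exists_isCompact_sdiff_lt
      (measure_ne_top (A.measure ψ) _) (ENNReal.ofReal_pos.2 (half_pos hε)).ne'
    refine ⟨K, hK, ?_⟩
    rw [← Set.compl_eq_univ_sdiff, A.measure_apply ψ hK.measurableSet.compl] at hKε
    exact ((ENNReal.ofReal_lt_ofReal_iff (half_pos hε)).1 hKε).le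
  obtain ⟨K₁, hK₁, h₁⟩ := hK E
  obtain ⟨K₂, hK₂, h₂⟩ := hK F
  refine ⟨K₁ ×ˢ K₂, hK₁.prod hK₂, ?_⟩
  have m₁ := hK₁.measurableSet
  have m₂ := hK₂.measurableSet
  rw [← hE _ m₁.compl] at h₁
  rw [← hF _ m₂.compl] at h₂
  have hm := hg.form ψ
  -- The complement of the rectangle lies in two strips, each of mass at most `ε / 2` by the
  -- margins.
  have hcov : (Set.univ : Set (ℝ × ℝ)) = K₁ ×ˢ K₂ ∪ (K₁ᶜ ×ˢ Set.univ ∪ Set.univ ×ˢ K₂ᶜ) := by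
    ext z
    simp only [Set.mem_univ, Set.mem_union, Set.mem_prod, Set.mem_compl_iff, true_and, and_true,
      true_iff]
    tauto
  have l₁ := hm.union_le (m₁.prod m₂) ((m₁.compl.prod .univ).union (MeasurableSet.univ.prod m₂.compl))
  have l₂ := hm.union_le (m₁.compl.prod .univ) (MeasurableSet.univ.prod m₂.compl)
  rw [← hcov] at l₁
  linarith

end IsFinAdditiveOp

end OperatorMeasures

/-! ### Averaging over a projective representation. -/

section CovariantAverage

variable {H : Type*} [NormedAddCommGroup H] [InnerProductSpace ℂ H] [CompleteSpace H]

open ContinuousLinearMap in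
/-- The map `T ↦ S* T S`. -/
noncomputable def conjBy (S : H →L[ℂ] H) : (H →L[ℂ] H) →ₗ[ℝ] (H →L[ℂ] H) where
  toFun T := adjoint S ∘L T ∘L S
  map_add' T T' := by rw [add_comp, comp_add]
  map_smul' c T := by ext x; simp

theorem conjBy_apply (S T : H →L[ℂ] H) :
    conjBy S T = ContinuousLinearMap.adjoint S ∘L T ∘L S := rfl

theorem inner_conjBy (S T : H →L[ℂ] H) (φ ψ : H) : ⟪φ, conjBy S T ψ⟫_ℂ = ⟪S φ, T (S ψ)⟫_ℂ := by
  rw [conjBy_apply, ContinuousLinearMap.comp_apply, ContinuousLinearMap.adjoint_inner_right]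
  rfl

theorem conjBy_smul_left {c : ℂ} (hc : ‖c‖ = 1) (S T : H →L[ℂ] H) :
    conjBy (c • S) T = conjBy S T := by
  refine ext_inner_self fun ψ => ?_
  have h : (starRingEnd ℂ) c * c = 1 := by
    rw [mul_comm, Complex.mul_conj, Complex.normSq_eq_norm_sq, hc]; simp
  rw [inner_conjBy, inner_conjBy, smul_apply, map_smul, inner_smul_left,
    inner_smul_right, ← mul_assoc, h, one_mul]

theorem conjBy_conjBy (S S' T : H →L[ℂ] H) : conjBy S (conjBy S' T) = conjBy (S' ∘L S) T :=
  ext_inner_self fun ψ => by simp only [inner_conjBy, ContinuousLinearMap.comp_apply]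

theorem norm_conjBy_le {S : H →L[ℂ] H} (hS : ContinuousLinearMap.adjoint S ∘L S = 1)
    (T : H →L[ℂ] H) : ‖conjBy S T‖ ≤ ‖T‖ := by
  have hS' : ‖S‖ ≤ 1 := S.opNorm_le_bound zero_le_one fun x => by
    rw [one_mul, (S.norm_map_iff_adjoint_comp_self).2 hS x]
  have hS'' : ‖ContinuousLinearMap.adjoint S‖ ≤ 1 := by rwa [LinearIsometryEquiv.norm_map]
  calc ‖conjBy S T‖ ≤ ‖ContinuousLinearMap.adjoint S‖ * (‖T‖ * ‖S‖) :=
        (ContinuousLinearMap.opNorm_comp_le _ _).trans (by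
          gcongr; exact ContinuousLinearMap.opNorm_comp_le _ _)
    _ ≤ 1 * (‖T‖ * 1) := by gcongr
    _ = ‖T‖ := by ring

/-- Averaging an observable over a projective isometric representation of an abelian group: the
resulting finitely additive set function is covariant, and it agrees with the given observable on
the sets where the latter is already covariant. -/
theorem exists_covariant_average {G : Type*} [AddCommGroup G] [MeasurableSpace G] [MeasurableAdd G]
    (M : Observable G H) {D : G → H →L[ℂ] H}
    (hD : ∀ z, ContinuousLinearMap.adjoint (D z) ∘L D z = 1)
    (hDD : ∀ z w, ∃ c : ℂ, ‖c‖ = 1 ∧ D z ∘L D w = c • D (z + w)) :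
    ∃ g : Set G → H →L[ℂ] H, IsFinAdditiveOp g ∧
      (∀ Z, MeasurableSet Z → ∀ w, conjBy (D w) (g ((fun z => z + w) '' Z)) = g Z) ∧
      ∀ Z, MeasurableSet Z → ∀ T, (∀ w, conjBy (D w) (M.op ((fun z => z + w) '' Z)) = T) →
        g Z = T := by
  let f : Set G → G → H →L[ℂ] H := fun Z w => conjBy (D w) (M.op ((fun z => z + w) '' Z))
  have himg : ∀ {Z : Set G}, MeasurableSet Z → ∀ w, MeasurableSet ((fun z => z + w) '' Z) :=
    fun hZ w => (MeasurableEquiv.addRight w).measurableSet_image.2 hZ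
  have hf : ∀ Z, MeasurableSet Z → ∀ w, ‖f Z w‖ ≤ 1 := fun Z hZ w =>
    (norm_conjBy_le (hD w) _).trans (M.isFinAdditiveOp.norm_le_one (himg hZ w))
  let l := Ultrafilter.of (atTop : Filter (Finset (G × ℕ)))
  have hex : ∀ Z, MeasurableSet Z → ∃ T : H →L[ℂ] H, ∀ φ ψ : H,
      Tendsto (fun s : Finset (G × ℕ) => ⟪φ, avg s.toList (f Z) 0 ψ⟫_ℂ) l (𝓝 ⟪φ, T ψ⟫_ℂ) :=
    fun Z hZ => exists_weak_limit l _ fun s => avg_norm_le _ (hf Z hZ) 0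
  choose! g hg using hex
  have hconst : ∀ Z, MeasurableSet Z → ∀ T, (∀ w, f Z w = T) → g Z = T := fun Z hZ T hT =>
    ext_inner_self fun ψ => tendsto_nhds_unique (hg Z hZ ψ ψ) (by
      rw [funext hT]
      simp only [avg_const]
      exact tendsto_const_nhds)
  refine ⟨g, ⟨fun X hX => ?_, ?_, fun X Y hX hY hd => ?_⟩, fun Z hZ w => ?_, hconst⟩
  · have hfpos : ∀ w, (f X w).IsPositive := fun w =>
      (M.isPositive _ (himg hX w)).adjoint_conj (D w)
    have hpos : ∀ s : Finset (G × ℕ), (avg s.toList (f X) 0).IsPositive := fun s =>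
      avg_mem_of_convex (s := {T : H →L[ℂ] H | T.IsPositive}) convex_isPositive s.toList hfpos 0
    refine isPositive_of_inner_eq_ofReal (r := fun ψ => (⟪ψ, g X ψ⟫_ℂ).re) (fun ψ => ?_) fun ψ => ?_
    · exact ge_of_tendsto' ((Complex.continuous_re.tendsto _).comp (hg X hX ψ ψ))
        fun s => (hpos s).re_inner_nonneg_right ψ
    · refine tendsto_nhds_unique (hg X hX ψ ψ) (((Complex.continuous_ofReal.tendsto _).comp
        ((Complex.continuous_re.tendsto _).comp (hg X hX ψ ψ))).congr fun s => ?_)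
      exact (inner_eq_ofReal_re (hpos s) ψ).symm
  · refine hconst _ .univ _ fun w => ?_
    change conjBy (D w) _ = _
    rw [Set.image_univ_of_surjective (add_right_surjective w), M.op_univ]
    exact hD w
  · refine ext_inner_self fun ψ => tendsto_nhds_unique (hg _ (hX.union hY) ψ ψ) ?_
    rw [add_apply, inner_add_right]
    refine ((hg X hX ψ ψ).add (hg Y hY ψ ψ)).congr fun s => ?_
    have h : f (X ∪ Y) = fun w => f X w + f Y w := funext fun w => by
      change conjBy (D w) _ = _
      rw [Set.image_union, M.op_union (himg hX w) (himg hY w)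
        ((Set.disjoint_image_iff (add_left_injective w)).2 hd), map_add]
    rw [h, avg_add, add_apply, inner_add_right]
  -- Conjugation does not see the unimodular multiplier, so covariance of the limit becomes shift
  -- invariance of the mean.
  · have hshift : (fun z => conjBy (D w) (f ((fun z => z + w) '' Z) z)) = fun z => f Z (z + w) := by
      funext z
      obtain ⟨c, hc, hcc⟩ := hDD z w
      change conjBy (D w) (conjBy (D z) _) = conjBy (D (z + w)) _
      rw [conjBy_conjBy, hcc, conjBy_smul_left hc, Set.image_image]
      simp only [add_assoc, add_comm w z]
    have hlim := (tendsto_avg_shift_sub (hf Z hZ) w).mono_left (Ultrafilter.of_le _)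
    rw [← hshift] at hlim
    simp only [avg_map] at hlim
    refine ext_inner_self fun ψ => ?_
    rw [inner_conjBy]
    refine tendsto_nhds_unique (hg _ (himg hZ w) (D w ψ) (D w ψ)) ?_
    have hc : Continuous fun T : H →L[ℂ] H => ⟪ψ, T ψ⟫_ℂ := by fun_prop
    have h := ((hc.tendsto _).comp hlim).add (hg Z hZ ψ ψ)
    simp only [zero_apply, inner_zero_right, zero_add] at h
    refine h.congr fun s => ?_
    simp only [Function.comp_apply, sub_apply, inner_sub_right, inner_conjBy, sub_add_cancel]

end CovariantAverage

/-! ### Weyl operators and covariance of the margins. -/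

section Weyl

open ContinuousLinearMap (adjoint)

theorem W_apply_ae (q p : ℝ) (ψ : L2R) : (W q p ψ : ℝ → ℂ) =ᵐ[volume] fun x =>
    Complex.exp (Complex.I * q * p / 2 + Complex.I * p * (x - q)) * (ψ : ℝ → ℂ) (x - q) := by
  have hV := (measurePreserving_sub_right volume q).quasiMeasurePreserving.ae_eq_comp
    (V_apply_ae p ψ)
  filter_upwards [Lp.coeFn_smul (Complex.exp (Complex.I * q * p / 2)) (U q (V p ψ)),
    U_apply_ae q (V p ψ), hV] with x h₁ h₂ h₃
  change (Complex.exp (Complex.I * q * p / 2) • U q (V p ψ) : L2R) x = _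
  simp only [Function.comp_apply] at h₃
  rw [h₁, Pi.smul_apply, h₂, h₃, smul_eq_mul, Complex.exp_add]
  push_cast
  ring

theorem W_comp_W (q p q' p' : ℝ) : W q p ∘L W q' p' =
    Complex.exp (((q' * p - q * p') / 2 : ℝ) * Complex.I) • W (q + q') (p + p') := by
  ext1 ψ
  refine Lp.ext ?_
  have h' := (measurePreserving_sub_right volume q).quasiMeasurePreserving.ae_eq_comp
    (W_apply_ae q' p' ψ)
  filter_upwards [W_apply_ae q p (W q' p' ψ), h', W_apply_ae (q + q') (p + p') ψ,
    Lp.coeFn_smul (Complex.exp (((q' * p - q * p') / 2 : ℝ) * Complex.I)) (W (q + q') (p + p') ψ)]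
    with x h₁ h₂ h₃ h₄
  simp only [Function.comp_apply] at h₂
  change (W q p (W q' p' ψ) : L2R) x = (Complex.exp _ • W (q + q') (p + p') ψ : L2R) x
  rw [h₁, h₂, h₄, Pi.smul_apply, h₃, smul_eq_mul, ← mul_assoc, ← mul_assoc, ← Complex.exp_add,
    ← Complex.exp_add, sub_sub]
  congr 2
  push_cast
  ring

theorem W_zero : W 0 0 = 1 := by
  ext1 ψ
  refine Lp.ext ?_
  filter_upwards [W_apply_ae 0 0 ψ] with x h
  simpa using h

theorem adjoint_U_comp (q : ℝ) : adjoint (U q) ∘L U q = 1 :=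
  (U q).norm_map_iff_adjoint_comp_self.1 (LinearIsometry.norm_map _)

theorem adjoint_V_comp (p : ℝ) : adjoint (V p) ∘L V p = 1 :=
  (V p).norm_map_iff_adjoint_comp_self.1 fun ψ => by
    rw [V, LinearIsometry.coe_toContinuousLinearMap, LinearIsometry.norm_map]

theorem norm_exp_ofReal_div_two (q p : ℝ) : ‖Complex.exp (Complex.I * q * p / 2)‖ = 1 := by
  rw [show Complex.I * q * p / 2 = ((q * p / 2 : ℝ) : ℂ) * Complex.I by push_cast; ring,
    Complex.norm_exp_ofReal_mul_I]

theorem conjBy_W (q p : ℝ) (T : L2R →L[ℂ] L2R) : conjBy (W q p) T = conjBy (V p) (conjBy (U q) T) := by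
  rw [W, conjBy_smul_left (norm_exp_ofReal_div_two q p), conjBy_conjBy]

theorem conjBy_conj_adjoint {H : Type*} [NormedAddCommGroup H] [InnerProductSpace ℂ H]
    [CompleteSpace H] {S : H →L[ℂ] H} (hS : adjoint S ∘L S = 1) (T : H →L[ℂ] H) :
    conjBy S (S ∘L T ∘L adjoint S) = T := by
  have h : ∀ x, adjoint S (S x) = x := fun x => congrArg (fun A : H →L[ℂ] H => A x) hS
  ext1 x
  simp only [conjBy_apply, ContinuousLinearMap.comp_apply, h]

theorem adjoint_W_comp (q p : ℝ) : adjoint (W q p) ∘L W q p = 1 := by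
  have h := conjBy_W q p 1
  simp only [conjBy_apply] at h
  have h1 : ∀ T : L2R →L[ℂ] L2R, (1 : L2R →L[ℂ] L2R) ∘L T = T := fun _ => rfl
  rwa [h1, h1, adjoint_U_comp, h1, adjoint_V_comp] at h

/-- The multiplier of `(q, p)` and `(-q, -p)` is trivial, so `W (-q) (-p)` is a right inverse and
must equal the left inverse `adjoint (W q p)`. -/
theorem W_comp_adjoint (q p : ℝ) : W q p ∘L adjoint (W q p) = 1 := by
  have h := W_comp_W q p (-q) (-p)
  rw [add_neg_cancel, add_neg_cancel, W_zero, show (-q * p - q * -p) / 2 = 0 by ring,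
    Complex.ofReal_zero, zero_mul, Complex.exp_zero, one_smul] at h
  have e : adjoint (W q p) = W (-q) (-p) :=
    left_inv_eq_right_inv (a := W q p) (adjoint_W_comp q p) h
  rw [e, h]

theorem image_prod_add (X Y : Set ℝ) (z : ℝ × ℝ) :
    (fun w => w + z) '' X ×ˢ Y = ((fun x => x + z.1) '' X) ×ˢ ((fun y => y + z.2) '' Y) :=
  Set.prodMap_image_prod (fun x => x + z.1) (fun y => y + z.2) X Y

theorem IsPositionObservable.conjBy_W {E : Observable ℝ L2R} (hE : IsPositionObservable E) (q p : ℝ)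
    {X : Set ℝ} (hX : MeasurableSet X) : conjBy (W q p) (E.op ((fun x => x + q) '' X)) = E.op X := by
  rw [PhaseSpace.conjBy_W, ← (hE q p X hX).1, conjBy_conj_adjoint (adjoint_U_comp q)]
  nth_rewrite 1 [← (hE q p X hX).2]
  rw [conjBy_conj_adjoint (adjoint_V_comp p)]

theorem IsMomentumObservable.conjBy_W {F : Observable ℝ L2R} (hF : IsMomentumObservable F) (q p : ℝ)
    {Y : Set ℝ} (hY : MeasurableSet Y) : conjBy (W q p) (F.op ((fun y => y + p) '' Y)) = F.op Y := by
  have hY' : MeasurableSet ((fun y => y + p) '' Y) :=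
    (MeasurableEquiv.addRight p).measurableSet_image.2 hY
  rw [PhaseSpace.conjBy_W]
  nth_rewrite 1 [← (hF q p _ hY').2]
  rw [conjBy_conj_adjoint (adjoint_U_comp q), ← (hF q p Y hY).1,
    conjBy_conj_adjoint (adjoint_V_comp p)]

end Weyl

/-- Applied to the two coordinate projections, this shows that regularizing `g` leaves its margins
unchanged. -/
theorem IsFinAdditiveOp.op_preimage_eq {H : Type*} [NormedAddCommGroup H] [InnerProductSpace ℂ H]
    {g : Set (ℝ × ℝ) → H →L[ℂ] H} (hg : IsFinAdditiveOp g) {G : Observable (ℝ × ℝ) H}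
    (hG : ∀ Z, MeasurableSet Z → ∀ ψ, ⟪ψ, G.op Z ψ⟫_ℂ = (hg.form ψ).innerMeasure.real Z)
    (ht : ∀ ψ, ∀ ε > 0, ∃ K : Set (ℝ × ℝ), IsCompact K ∧
      (⟪ψ, g Set.univ ψ⟫_ℂ).re ≤ (⟪ψ, g K ψ⟫_ℂ).re + ε)
    {f : ℝ × ℝ → ℝ} (hf : Continuous f) {E : Observable ℝ H}
    (hE : ∀ X, MeasurableSet X → g (f ⁻¹' X) = E.op X) {X : Set ℝ} (hX : MeasurableSet X) :
    G.op (f ⁻¹' X) = E.op X := by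
  refine ext_inner_self fun ψ => ?_
  have h := (hg.form ψ).map_innerMeasure (ht ψ) hf (μ := E.measure ψ) fun X hX => by
    rw [E.measure_apply ψ hX.measurableSet, hE X hX.measurableSet]
  rw [hG _ (hf.measurable hX), E.inner_op_self ψ hX, ← h, map_measureReal_apply hf.measurable hX]

end PhaseSpace

open PhaseSpace in
theorem mainTheorem1 (E F : PhaseSpace.Observable ℝ PhaseSpace.L2R)
    (hE : PhaseSpace.IsPositionObservable E) (hF : PhaseSpace.IsMomentumObservable F)
    (hEF : ∃ M : PhaseSpace.Observable (ℝ × ℝ) PhaseSpace.L2R,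
      PhaseSpace.IsJointObservable M E F) :
    ∃ G : PhaseSpace.Observable (ℝ × ℝ) PhaseSpace.L2R,
      PhaseSpace.IsJointObservable G E F ∧ PhaseSpace.IsCovariantPhaseSpaceObservable G := by
  obtain ⟨M, hME, hMF⟩ := hEF
  obtain ⟨g, hg, hcov, hconst⟩ := exists_covariant_average M (D := fun z : ℝ × ℝ => W z.1 z.2)
    (fun z => adjoint_W_comp z.1 z.2)
    (fun z w => ⟨_, Complex.norm_exp_ofReal_mul_I _, W_comp_W z.1 z.2 w.1 w.2⟩)
  have himg : ∀ {X : Set ℝ}, MeasurableSet X → ∀ q, MeasurableSet ((fun x => x + q) '' X) :=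
    fun hX q => (MeasurableEquiv.addRight q).measurableSet_image.2 hX
  have huniv : ∀ q : ℝ, (fun x => x + q) '' Set.univ = Set.univ := fun q =>
    Set.image_univ_of_surjective (add_right_surjective q)
  have hgE : ∀ X, MeasurableSet X → g (X ×ˢ Set.univ) = E.op X := fun X hX =>
    hconst _ (hX.prod .univ) _ fun w => by
      rw [image_prod_add, huniv, ← hME _ (himg hX _), hE.conjBy_W _ _ hX]
  have hgF : ∀ Y, MeasurableSet Y → g (Set.univ ×ˢ Y) = F.op Y := fun Y hY =>
    hconst _ (MeasurableSet.univ.prod hY) _ fun w => by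
      rw [image_prod_add, huniv, ← hMF _ (himg hY _), hF.conjBy_W _ _ hY]
  have ht := fun ψ ε (hε : (0 : ℝ) < ε) => hg.tight_of_margins hgE hgF ψ hε
  obtain ⟨G, hG⟩ := hg.exists_observable ht
  refine ⟨G, ⟨fun X hX => ?_, fun Y hY => ?_⟩, fun q p Z hZ => ?_⟩
  · rw [Set.prod_univ]
    exact (hg.op_preimage_eq hG ht continuous_fst
      (fun X hX => Set.prod_univ ▸ hgE X hX) hX).symm
  · rw [Set.univ_prod]
    exact (hg.op_preimage_eq hG ht continuous_snd
      (fun X hX => Set.univ_prod ▸ hgF X hX) hY).symm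
  · have hpre : ∀ K : Set (ℝ × ℝ),
        (fun z => z + (q, p)) '' K = Homeomorph.addRight (-(q, p)) ⁻¹' K := fun K =>
      (Homeomorph.addRight (q, p)).image_eq_preimage_symm K
    have hZ' : MeasurableSet ((fun z => z + (q, p)) '' Z) :=
      (MeasurableEquiv.addRight (q, p)).measurableSet_image.2 hZ
    have hWW : ∀ x, W q p (ContinuousLinearMap.adjoint (W q p) x) = x := fun x =>
      congrArg (fun A : L2R →L[ℂ] L2R => A x) (W_comp_adjoint q p)
    refine ext_inner_self fun ψ => ?_
    -- Covariance of `g` on compact sets relates the form at `ψ` on a translate to the form at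
    -- `W(q,p)* ψ`; the inner measures inherit the relation on all Borel sets.
    have h := (hg.form ψ).innerMeasure_preimage
      (hg.form (ContinuousLinearMap.adjoint (W q p) ψ)) (Homeomorph.addRight (-(q, p)))
      (fun K hK => by
        rw [← hpre, ← hcov K hK.measurableSet (q, p), inner_conjBy, hWW]) hZ
    rw [← hpre] at h
    rw [ContinuousLinearMap.comp_apply, ContinuousLinearMap.comp_apply,
      ← ContinuousLinearMap.adjoint_inner_left, hG Z hZ,
      hG _ hZ', measureReal_def, measureReal_def, ← h]
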